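/- Let $r,n$ be natural numbers. All germs are germs at $0$ and are either all smooth or all real-analytic. Fix a germ $\Omega$ of a volume form on $(\mathbb R^r,0)$. Let $C^\infty(\mathbb R^r,\mathrm{Sym}_n)$ and $C^\infty(\mathbb R^r,\mathrm{GL}_n)$ denote the sets of germs at $0$ of maps from $\mathbb R^r$ to the real symmetric, respectively invertible, $n\times n$ matrices (the value at $0$ is arbitrary). Two germs $A,B\in C^\infty(\mathbb R^r,\mathrm{Sym}_n)$ are called $\mathcal G$-equivalent if $B=X^T(A\circ\Phi)X$ for some diffeomorphism-germ $\Phi:(\mathbb R^r,0)\to(\mathbb R^r,0)$ and some $X\in C^\infty(\mathbb R^r,\mathrm{GL}_n)$. They are orientation-preserving equivalent if $\Phi$ can be chosen with $\det d\Phi|_0>0$, and volume-preserving equivalent if $\Phi$ can be chosen with $\Phi^*\Omega=\Omega$. Let $\mathcal D_A$ be the group of diffeomorphism-germs $\Phi:(\mathbb R^r,0)\to(\mathbb R^r,0)$ such that $A=X^T(A\circ\Phi)X$ for some $X\in C^\infty(\mathbb R^r,\mathrm{GL}_n)$. A germ $A$ is symmetrically quasi-homogeneous if there are local coordinates $(x_1,\dots,x_r)$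 centred at $0$, non-negative integers $\lambda_1,\dots,\lambda_r$ with $\sum_k\lambda_k>0$, non-negative integers $\delta_1,\dots,\delta_n$ and $X\in C^\infty(\mathbb R^r,\mathrm{GL}_n)$ such that $B=X^TAX$ satisfies, in these coordinates and as germs in $x$, $$B_{ij}(t^{\lambda_1}x_1,\dots,t^{\lambda_r}x_r)=t^{\frac12(\delta_i+\delta_j)}B_{ij}(x_1,\dots,x_r)$$ for all $i,j$ and every real $t$ for which the power on the right is defined (every $t$ if $\delta_i+\delta_j$ is even, every $t\ge 0$ if it is odd). Proposition. Let $A\in C^\infty(\mathbb R^r,\mathrm{Sym}_n)$ be symmetrically quasi-homogeneous. (1) If there is $\Phi\in\mathcal D_A$ with $\det d\Phi|_0<0$, then every $B\in C^\infty(\mathbb R^r,\mathrm{Sym}_n)$ that is $\mathcal G$-equivalent to $A$ is volume-preserving equivalent to $A$. (2) Suppose that $\det d\Phi|_0>0$ for every $\Phi\in\mathcal D_A$, and put $\bar A(x_1,x_2,\dots,x_r)=A(-x_1,x_2,\dots,x_r)$. Then: (a) every $B\in C^\infty(\mathbb R^r,\mathrm{Sym}_n)$ that is orientation-preserving equivalent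 to $A$ is volume-preserving equivalent to $A$; (b) every $B\in C^\infty(\mathbb R^r,\mathrm{Sym}_n)$ that is $\mathcal G$-equivalent but not orientation-preserving equivalent to $A$ is volume-preserving equivalent to $\bar A$; (c) $A$ and $\bar A$ are not volume-preserving equivalent. -/

import Mathlib

open Filter Topology
open scoped ContDiff Matrix

noncomputable section

/-! Germs at `0` are handled through representatives: a germ is a function defined everywhere, its
values away from `0` are irrelevant, and equality of germs is eventual equality near `0`.
The parameter `k` is the regularity class, `k = ∞` (smooth) or `k = ω` (real-analytic). -/

/-- `f` is of class `k` on some neighbourhood of `0` (for `k = ∞` this is stronger than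
`ContDiffAt ℝ k f 0`). -/
def IsRegularGerm {E F : Type*} [NormedAddCommGroup E] [NormedSpace ℝ E]
    [NormedAddCommGroup F] [NormedSpace ℝ F] (k : WithTop ℕ∞) (f : E → F) : Prop :=
  ∀ᶠ x in 𝓝 (0 : E), ContDiffAt ℝ k f x

/-- A map-germ at `0` of class `k` from `ℝ^r` to the `n × n` matrices. -/
def IsMatrixGerm {r n : ℕ} (k : WithTop ℕ∞)
    (A : (Fin r → ℝ) → Matrix (Fin n) (Fin n) ℝ) : Prop :=
  ∀ i j, IsRegularGerm k (fun x => A x i j)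

/-- A map-germ at `0` of class `k` from `ℝ^r` to the symmetric matrices. -/
def IsSymGerm {r n : ℕ} (k : WithTop ℕ∞)
    (A : (Fin r → ℝ) → Matrix (Fin n) (Fin n) ℝ) : Prop :=
  IsMatrixGerm k A ∧ ∀ᶠ x in 𝓝 (0 : Fin r → ℝ), (A x).IsSymm

/-- A map-germ at `0` of class `k` from `ℝ^r` to the general linear group. -/
def IsGLGerm {r n : ℕ} (k : WithTop ℕ∞)
    (X : (Fin r → ℝ) → Matrix (Fin n) (Fin n) ℝ) : Prop :=
  IsMatrixGerm k X ∧ ∀ᶠ x in 𝓝 (0 : Fin r → ℝ), IsUnit (X x)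

/-- A diffeomorphism-germ `(ℝ^r, 0) → (ℝ^r, 0)` of class `k`. -/
def IsDiffeoGerm {r : ℕ} (k : WithTop ℕ∞) (Φ : (Fin r → ℝ) → (Fin r → ℝ)) : Prop :=
  Φ 0 = 0 ∧ IsRegularGerm k Φ ∧
    ∃ Ψ : (Fin r → ℝ) → (Fin r → ℝ), Ψ 0 = 0 ∧ IsRegularGerm k Ψ ∧
      (∀ᶠ x in 𝓝 0, Ψ (Φ x) = x) ∧ (∀ᶠ x in 𝓝 0, Φ (Ψ x) = x)

def IsOrientationPreserving {r : ℕ} (Φ : (Fin r → ℝ) → (Fin r → ℝ)) : Prop :=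
  0 < (fderiv ℝ Φ 0).det

def IsOrientationReversing {r : ℕ} (Φ : (Fin r → ℝ) → (Fin r → ℝ)) : Prop :=
  (fderiv ℝ Φ 0).det < 0

/-- A germ at `0` of a volume form of class `k` on `ℝ^r`: a nowhere vanishing `r`-form. -/
def IsVolumeFormGerm {r : ℕ} (k : WithTop ℕ∞)
    (Ω : (Fin r → ℝ) → (Fin r → ℝ) [⋀^Fin r]→L[ℝ] ℝ) : Prop :=
  IsRegularGerm k Ω ∧ ∀ᶠ x in 𝓝 0, Ω x ≠ 0

/-- The pull-back `Φ^* Ω` of a differential form. -/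
def pullbackForm {r : ℕ} (Φ : (Fin r → ℝ) → (Fin r → ℝ))
    (Ω : (Fin r → ℝ) → (Fin r → ℝ) [⋀^Fin r]→L[ℝ] ℝ) :
    (Fin r → ℝ) → (Fin r → ℝ) [⋀^Fin r]→L[ℝ] ℝ :=
  fun x => (Ω (Φ x)).compContinuousLinearMap (fderiv ℝ Φ x)

/-- The germ of `Φ` satisfies `Φ^* Ω = Ω`. -/
def PreservesForm {r : ℕ} (Ω : (Fin r → ℝ) → (Fin r → ℝ) [⋀^Fin r]→L[ℝ] ℝ)
    (Φ : (Fin r → ℝ) → (Fin r → ℝ)) : Prop :=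
  pullbackForm Φ Ω =ᶠ[𝓝 0] Ω

/-- `B = Xᵀ (A ∘ Φ) X` as germs at `0`, for some germ `X` of maps into the general linear group. -/
def IsCongruentVia {r n : ℕ} (k : WithTop ℕ∞) (Φ : (Fin r → ℝ) → (Fin r → ℝ))
    (A B : (Fin r → ℝ) → Matrix (Fin n) (Fin n) ℝ) : Prop :=
  ∃ X : (Fin r → ℝ) → Matrix (Fin n) (Fin n) ℝ, IsGLGerm k X ∧
    B =ᶠ[𝓝 0] fun x => (X x)ᵀ * A (Φ x) * X x

/-- `𝓖`-equivalence. -/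
def GEquivalent {r n : ℕ} (k : WithTop ℕ∞)
    (A B : (Fin r → ℝ) → Matrix (Fin n) (Fin n) ℝ) : Prop :=
  ∃ Φ : (Fin r → ℝ) → (Fin r → ℝ), IsDiffeoGerm k Φ ∧ IsCongruentVia k Φ A B

/-- Orientation-preserving equivalence. -/
def OrientationPreservingEquivalent {r n : ℕ} (k : WithTop ℕ∞)
    (A B : (Fin r → ℝ) → Matrix (Fin n) (Fin n) ℝ) : Prop :=
  ∃ Φ : (Fin r → ℝ) → (Fin r → ℝ), IsDiffeoGerm k Φ ∧ IsOrientationPreserving Φ ∧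
    IsCongruentVia k Φ A B

/-- Volume-preserving (unimodular) equivalence with respect to the volume form-germ `Ω`. -/
def VolumePreservingEquivalent {r n : ℕ} (k : WithTop ℕ∞)
    (Ω : (Fin r → ℝ) → (Fin r → ℝ) [⋀^Fin r]→L[ℝ] ℝ)
    (A B : (Fin r → ℝ) → Matrix (Fin n) (Fin n) ℝ) : Prop :=
  ∃ Φ : (Fin r → ℝ) → (Fin r → ℝ), IsDiffeoGerm k Φ ∧ PreservesForm Ω Φ ∧
    IsCongruentVia k Φ A B

/-- The isotropy group `𝓓_A`, as a set of (representatives of) diffeomorphism-germs. -/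
def isotropyGroup {r n : ℕ} (k : WithTop ℕ∞)
    (A : (Fin r → ℝ) → Matrix (Fin n) (Fin n) ℝ) : Set ((Fin r → ℝ) → (Fin r → ℝ)) :=
  {Φ | IsDiffeoGerm k Φ ∧ IsCongruentVia k Φ A A}

/-- `A` is symmetrically quasi-homogeneous: in some coordinate system (given by the
diffeomorphism-germ `φ`) a matrix `B = Xᵀ A X` satisfies
`B_ij (t^λ_1 x_1, …, t^λ_r x_r) = t^((δ_i + δ_j)/2) B_ij (x_1, …, x_r)`, as germs in `x` at `0`,
for every real `t` for which the power on the right is defined, that is, for every `t` if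
`δ_i + δ_j` is even and for every `t ≥ 0` if it is odd. -/
def IsSymQuasiHomogeneous {r n : ℕ} (k : WithTop ℕ∞)
    (A : (Fin r → ℝ) → Matrix (Fin n) (Fin n) ℝ) : Prop :=
  ∃ (φ : (Fin r → ℝ) → (Fin r → ℝ)) (w : Fin r → ℕ) (δ : Fin n → ℕ)
    (X B : (Fin r → ℝ) → Matrix (Fin n) (Fin n) ℝ),
    IsDiffeoGerm k φ ∧ IsGLGerm k X ∧ 0 < ∑ l, w l ∧
    (B = fun x => (X x)ᵀ * A (φ x) * X x) ∧
    ∀ (t : ℝ) (i j : Fin n), (0 ≤ t ∨ Even (δ i + δ j)) →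
      ∀ᶠ x in 𝓝 (0 : Fin r → ℝ),
        B (fun l => t ^ w l * x l) i j = t ^ (((δ i : ℝ) + (δ j : ℝ)) / 2) * B x i j

/-- `Ā (x_1, x_2, …, x_r) = A (-x_1, x_2, …, x_r)`. -/
def reflectFirst {r n : ℕ} (A : (Fin r → ℝ) → Matrix (Fin n) (Fin n) ℝ) :
    (Fin r → ℝ) → Matrix (Fin n) (Fin n) ℝ :=
  fun x => A (fun l => if (l : ℕ) = 0 then -x l else x l)

end

/-! ### Calculus of germs -/

section RegularGerm

variable {E F G : Type*} [NormedAddCommGroup E] [NormedSpace ℝ E] [NormedAddCommGroup F]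
  [NormedSpace ℝ F] [NormedAddCommGroup G] [NormedSpace ℝ G] {k : WithTop ℕ∞}

/-! Everything reduces to one fact: `𝓓_A` acts transitively on volume forms of a given sign. Suppose
B = Xᵀ(A∘Φ)X with det dΦ(0) > 0. Choose Θ in `𝓓_A` with Θ^*Ω = (Φ⁻¹)^*Ω. Then Θ∘Φ preserves Ω and
still carries A to B. The three cases of the theorem differ only in how a Φ with positive
determinant is obtained.

Transitivity needs no flow. In quasi-homogeneous coordinates let D_t be the weighted dilation, N > 0
the sum of the weights and E = Σ w_l x_l ∂_l. For a positive function s, the map x ↦ D_{s(x)} x is a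
symmetry of the quasi-homogeneous matrix, by congruence with diag(s^(-δ_i/2)). Its Jacobian is s^N
(1 + s⁻¹ E s), which is F + E F / N for F = s^N. The equation F + E F / N = f is linear and is
solved by the average F(x) = ∫₀¹ N t^(N-1) f(D_t x) dt, with F(0) = f(0)
(`exists_weightedDilation_jacobian_eq`). So every density of the sign of a constant c is a pull-back
of c.

Two points need analysis. The average must keep the class of f, smooth or analytic
(`isRegularGerm_weightedAverage`). Quasi-homogeneity, given on a neighbourhood depending on t, must
hold uniformly in t before s(x) can be substituted (`exists_ball_quasiHomogeneous`, by Baire). -/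

theorem IsRegularGerm.contDiffAt {f : E → F} (hf : IsRegularGerm k f) : ContDiffAt ℝ k f 0 :=
  hf.self_of_nhds

theorem IsRegularGerm.comp {g : F → G} {f : E → F} (hg : IsRegularGerm k g)
    (hf : IsRegularGerm k f) (h0 : f 0 = 0) : IsRegularGerm k (fun x => g (f x)) := by
  have hc : Tendsto f (𝓝 0) (𝓝 0) := by
    simpa [h0] using hf.contDiffAt.continuousAt.tendsto
  filter_upwards [hf, hc.eventually hg] with x hx hgx
  exact ContDiffAt.comp x hgx hx

theorem isRegularGerm_const (c : F) : IsRegularGerm k (fun _ : E => c) :=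
  Eventually.of_forall fun _ => contDiffAt_const

theorem isRegularGerm_of_contDiff {f : E → F} (hf : ContDiff ℝ k f) : IsRegularGerm k f :=
  Eventually.of_forall fun _ => hf.contDiffAt

theorem IsRegularGerm.mul {f g : E → ℝ} (hf : IsRegularGerm k f) (hg : IsRegularGerm k g) :
    IsRegularGerm k (fun x => f x * g x) := by
  filter_upwards [hf, hg] with x h1 h2 using h1.mul h2

theorem isRegularGerm_sum {ι : Type*} {s : Finset ι} {f : ι → E → ℝ}
    (hf : ∀ i ∈ s, IsRegularGerm k (f i)) : IsRegularGerm k (fun x => ∑ i ∈ s, f i x) := by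
  have : ∀ᶠ x in 𝓝 (0 : E), ∀ i ∈ s, ContDiffAt ℝ k (f i) x :=
    (eventually_all_finset s).2 hf
  filter_upwards [this] with x hx using ContDiffAt.sum hx

theorem isRegularGerm_prod {ι : Type*} {s : Finset ι} {f : ι → E → ℝ}
    (hf : ∀ i ∈ s, IsRegularGerm k (f i)) : IsRegularGerm k (fun x => ∏ i ∈ s, f i x) := by
  have : ∀ᶠ x in 𝓝 (0 : E), ∀ i ∈ s, ContDiffAt ℝ k (f i) x :=
    (eventually_all_finset s).2 hf
  filter_upwards [this] with x hx using contDiffAt_prod hx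

theorem IsRegularGerm.rpow_const {f : E → ℝ} (hf : IsRegularGerm k f) (h0 : f 0 ≠ 0) (p : ℝ) :
    IsRegularGerm k (fun x => f x ^ p) := by
  filter_upwards [hf, hf.contDiffAt.continuousAt.eventually_ne h0] with x hx hne
  exact hx.rpow_const_of_ne hne

theorem IsRegularGerm.inv {f : E → ℝ} (hf : IsRegularGerm k f) (h0 : f 0 ≠ 0) :
    IsRegularGerm k (fun x => (f x)⁻¹) := by
  filter_upwards [hf, hf.contDiffAt.continuousAt.eventually_ne h0] with x hx hne
  exact hx.inv hne

theorem IsRegularGerm.pow {f : E → ℝ} (hf : IsRegularGerm k f) (m : ℕ) :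
    IsRegularGerm k (fun x => f x ^ m) := by
  filter_upwards [hf] with x hx using hx.pow m

theorem isRegularGerm_pi {ι : Type*} [Fintype ι] {f : E → ι → ℝ} :
    IsRegularGerm k f ↔ ∀ i, IsRegularGerm k (fun x => f x i) := by
  simp only [IsRegularGerm, contDiffAt_pi, eventually_all]

theorem IsRegularGerm.fderiv_apply {f : E → F} (hf : IsRegularGerm k f) (hk : k + 1 ≤ k) (v : E) :
    IsRegularGerm k (fun x => fderiv ℝ f x v) := by
  filter_upwards [hf] with x hx
  exact (hx.fderiv_right hk).clm_apply contDiffAt_const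

theorem IsRegularGerm.eventually_differentiableAt {f : E → F} (hf : IsRegularGerm k f)
    (hk : k ≠ 0) : ∀ᶠ x in 𝓝 0, DifferentiableAt ℝ f x := by
  filter_upwards [hf] with x hx using hx.differentiableAt hk

/-- In both classes differentiation costs no regularity, so Jacobians stay in class `k`. -/
theorem add_one_le_of_smooth_or_analytic (hk : k = ∞ ∨ k = ω) : k + 1 ≤ k := by
  rcases hk with rfl | rfl <;> simp

theorem ne_zero_of_smooth_or_analytic (hk : k = ∞ ∨ k = ω) : k ≠ 0 := by
  rcases hk with rfl | rfl <;> simp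

end RegularGerm

/-! ### Matrix-valued germs -/

section Matrices

variable {r n : ℕ} {k : WithTop ℕ∞} {X Y : (Fin r → ℝ) → Matrix (Fin n) (Fin n) ℝ}

theorem IsMatrixGerm.mul (hX : IsMatrixGerm k X) (hY : IsMatrixGerm k Y) :
    IsMatrixGerm k (fun x => X x * Y x) := fun i j => by
  simp only [Matrix.mul_apply]
  exact isRegularGerm_sum fun l _ => (hX i l).mul (hY l j)

theorem IsMatrixGerm.transpose (hX : IsMatrixGerm k X) : IsMatrixGerm k (fun x => (X x)ᵀ) :=
  fun i j => hX j i

theorem IsMatrixGerm.comp (hX : IsMatrixGerm k X) {Φ : (Fin r → ℝ) → (Fin r → ℝ)}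
    (hΦ : IsRegularGerm k Φ) (h0 : Φ 0 = 0) : IsMatrixGerm k (fun x => X (Φ x)) :=
  fun i j => (hX i j).comp hΦ h0

theorem IsMatrixGerm.det (hX : IsMatrixGerm k X) : IsRegularGerm k (fun x => (X x).det) := by
  simp only [Matrix.det_apply, zsmul_eq_mul, Units.smul_def]
  exact isRegularGerm_sum fun σ _ =>
    (isRegularGerm_const _).mul (isRegularGerm_prod fun i _ => hX _ _)

theorem IsGLGerm.inv (hX : IsGLGerm k X) : IsGLGerm k (fun x => (X x)⁻¹) := by
  refine ⟨fun i j => ?_, ?_⟩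
  · have h0 : (X 0).det ≠ 0 := by
      have := hX.2.self_of_nhds
      rw [Matrix.isUnit_iff_isUnit_det] at this
      exact this.ne_zero
    have hadj : IsRegularGerm k (fun x => (X x).adjugate i j) := by
      simp only [Matrix.adjugate_apply]
      refine IsMatrixGerm.det fun a b => ?_
      by_cases h : a = j
      · subst h
        simpa using isRegularGerm_const _
      · simpa [Matrix.updateRow_apply, h] using hX.1 a b
    simp only [Matrix.inv_def, Matrix.smul_apply, smul_eq_mul, Ring.inverse_eq_inv']
    exact (hX.1.det.inv h0).mul hadj
  · filter_upwards [hX.2] with x hx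
    exact Matrix.isUnit_nonsing_inv_iff.2 hx

theorem IsGLGerm.mul (hX : IsGLGerm k X) (hY : IsGLGerm k Y) : IsGLGerm k (fun x => X x * Y x) :=
  ⟨hX.1.mul hY.1, by filter_upwards [hX.2, hY.2] with x h1 h2 using h1.mul h2⟩

theorem IsGLGerm.comp (hX : IsGLGerm k X) {Φ : (Fin r → ℝ) → (Fin r → ℝ)}
    (hΦ : IsRegularGerm k Φ) (h0 : Φ 0 = 0) : IsGLGerm k (fun x => X (Φ x)) := by
  refine ⟨hX.1.comp hΦ h0, ?_⟩
  have hc : Tendsto Φ (𝓝 0) (𝓝 0) := by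
    simpa [h0] using hΦ.contDiffAt.continuousAt.tendsto
  exact hc.eventually hX.2

theorem isGLGerm_one : IsGLGerm k (fun _ : Fin r → ℝ => (1 : Matrix (Fin n) (Fin n) ℝ)) :=
  ⟨fun _ _ => isRegularGerm_const _, Eventually.of_forall fun _ => isUnit_one⟩

end Matrices

/-! ### Diffeomorphism-germs and their Jacobians -/

section DiffeoGerms

variable {r n : ℕ} {k : WithTop ℕ∞} {Φ Ψ : (Fin r → ℝ) → (Fin r → ℝ)}

theorem IsDiffeoGerm.tendsto (hΦ : IsDiffeoGerm k Φ) : Tendsto Φ (𝓝 0) (𝓝 0) := by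
  simpa [hΦ.1] using hΦ.2.1.contDiffAt.continuousAt.tendsto

theorem IsDiffeoGerm.exists_inverse (hΦ : IsDiffeoGerm k Φ) :
    ∃ Ψ, IsDiffeoGerm k Ψ ∧ (∀ᶠ x in 𝓝 0, Ψ (Φ x) = x) ∧ (∀ᶠ x in 𝓝 0, Φ (Ψ x) = x) := by
  obtain ⟨Ψ, h0, hr, h1, h2⟩ := hΦ.2.2
  exact ⟨Ψ, ⟨h0, hr, Φ, hΦ.1, hΦ.2.1, h2, h1⟩, h1, h2⟩

theorem IsDiffeoGerm.comp (hΦ : IsDiffeoGerm k Φ) (hΨ : IsDiffeoGerm k Ψ) :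
    IsDiffeoGerm k (fun x => Φ (Ψ x)) := by
  obtain ⟨Φ', hΦ', h1, h2⟩ := hΦ.exists_inverse
  obtain ⟨Ψ', hΨ', h3, h4⟩ := hΨ.exists_inverse
  refine ⟨by simp [hΦ.1, hΨ.1], hΦ.2.1.comp hΨ.2.1 hΨ.1, fun x => Ψ' (Φ' x),
    by simp [hΦ'.1, hΨ'.1], hΨ'.2.1.comp hΦ'.2.1 hΦ'.1, ?_, ?_⟩
  · filter_upwards [hΨ.tendsto.eventually h1, h3] with x hx hx'
    rw [hx, hx']
  · filter_upwards [hΦ'.tendsto.eventually h4, h2] with x hx hx'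
    rw [hx, hx']

theorem isRegularGerm_jacobian (hΦ : IsRegularGerm k Φ) (hk : k + 1 ≤ k) :
    IsRegularGerm k (fun x => (fderiv ℝ Φ x).det) := by
  have : ∀ x, (fderiv ℝ Φ x).det =
      (Matrix.of fun i j => fderiv ℝ Φ x (Pi.single j 1) i).det := by
    intro x
    rw [ContinuousLinearMap.det, ← LinearMap.det_toMatrix']
    congr 1
  simp only [this]
  exact IsMatrixGerm.det fun i j =>
    (isRegularGerm_pi.1 (hΦ.fderiv_apply hk (Pi.single j 1))) i

theorem jacobian_comp (hΦ : IsRegularGerm k Φ) (hΨ : IsRegularGerm k Ψ) (h0 : Ψ 0 = 0)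
    (hk : k ≠ 0) : ∀ᶠ x in 𝓝 0, (fderiv ℝ (fun x => Φ (Ψ x)) x).det =
      (fderiv ℝ Φ (Ψ x)).det * (fderiv ℝ Ψ x).det := by
  have hc : Tendsto Ψ (𝓝 0) (𝓝 0) := by
    simpa [h0] using hΨ.contDiffAt.continuousAt.tendsto
  filter_upwards [hc.eventually (hΦ.eventually_differentiableAt hk),
    hΨ.eventually_differentiableAt hk] with x h1 h2
  have := fderiv_comp x h1 h2
  change fderiv ℝ (fun x => Φ (Ψ x)) x = _ at this
  rw [this]
  exact LinearMap.det_comp _ _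

theorem jacobian_of_eventually_eq_id (h : ∀ᶠ x in 𝓝 0, Φ x = x) :
    ∀ᶠ x in 𝓝 0, (fderiv ℝ Φ x).det = 1 := by
  filter_upwards [h.eventually_nhds] with x hx
  have : Φ =ᶠ[𝓝 x] id := hx
  rw [this.fderiv_eq, fderiv_id]
  exact LinearMap.det_id

theorem IsDiffeoGerm.jacobian_ne_zero (hΦ : IsDiffeoGerm k Φ) (hk : k ≠ 0) :
    (fderiv ℝ Φ 0).det ≠ 0 := by
  obtain ⟨Ψ, hΨ, h1, h2⟩ := hΦ.exists_inverse
  have h := (jacobian_comp hΨ.2.1 hΦ.2.1 hΦ.1 hk).self_of_nhds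
  rw [(jacobian_of_eventually_eq_id h1).self_of_nhds] at h
  intro h'
  simp [h'] at h

theorem isDiffeoGerm_of_jacobian_ne_zero (hk : k ≠ 0) (h0 : Φ 0 = 0) (hΦ : IsRegularGerm k Φ)
    (hdet : (fderiv ℝ Φ 0).det ≠ 0) : IsDiffeoGerm k Φ := by
  have hd : ∀ x, DifferentiableAt ℝ Φ x → ∀ h : (fderiv ℝ Φ x).det ≠ 0,
      HasFDerivAt Φ ((ContinuousLinearMap.toContinuousLinearEquivOfDetNeZero _ h :
        (Fin r → ℝ) ≃L[ℝ] (Fin r → ℝ)) : (Fin r → ℝ) →L[ℝ] (Fin r → ℝ)) x := by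
    intro x hx h
    rw [ContinuousLinearMap.coe_toContinuousLinearEquivOfDetNeZero]
    exact hx.hasFDerivAt
  have h00 := hΦ.contDiffAt
  let e := h00.toOpenPartialHomeomorph Φ (hd 0 (h00.differentiableAt hk) hdet) hk
  have hs : (0 : Fin r → ℝ) ∈ e.source := h00.mem_toOpenPartialHomeomorph_source _ hk
  have he0 : e 0 = 0 := h0
  have ht : (0 : Fin r → ℝ) ∈ e.target := by rw [← he0]; exact e.map_source hs
  have hs0 : e.symm 0 = 0 := by
    conv_lhs => rw [← he0]
    exact e.left_inv hs
  have hcont : Tendsto e.symm (𝓝 0) (𝓝 0) := by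
    simpa [hs0] using (e.continuousAt_symm ht).tendsto
  -- A regular germ is of class `k` on a whole neighbourhood, so the inverse function theorem is
  -- needed at every point near `0`, not only at `0`.
  have hdet' : ∀ᶠ x in 𝓝 0, (fderiv ℝ Φ x).det ≠ 0 := by
    have h1 : ContDiffAt ℝ 1 Φ 0 := h00.of_le (ENat.one_le_iff_ne_zero_withTop.mpr hk)
    have h2 : ContinuousAt (fderiv ℝ Φ) 0 :=
      (h1.fderiv_right (m := 0) (by simp)).continuousAt
    exact (ContinuousLinearMap.continuous_det.continuousAt.comp h2).eventually_ne hdet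
  refine ⟨h0, hΦ, e.symm, hs0, ?_, ?_, ?_⟩
  · filter_upwards [hcont.eventually hΦ, hcont.eventually hdet', e.open_target.mem_nhds ht]
      with y h1 h2 h3
    exact e.contDiffAt_symm h3 (hd _ (h1.differentiableAt hk) h2) h1
  · filter_upwards [e.open_source.mem_nhds hs] with x hx using e.left_inv hx
  · filter_upwards [e.open_target.mem_nhds ht] with x hx using e.right_inv hx

/-! ### Congruence of matrix germs along diffeomorphism germs -/

variable {A B C : (Fin r → ℝ) → Matrix (Fin n) (Fin n) ℝ}

theorem IsCongruentVia.trans (hΨ : IsDiffeoGerm k Ψ) (h1 : IsCongruentVia k Φ A B)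
    (h2 : IsCongruentVia k Ψ B C) : IsCongruentVia k (fun x => Φ (Ψ x)) A C := by
  obtain ⟨X, hX, hB⟩ := h1
  obtain ⟨Y, hY, hC⟩ := h2
  refine ⟨fun x => X (Ψ x) * Y x, (hX.comp hΨ.2.1 hΨ.1).mul hY, ?_⟩
  filter_upwards [hC, hΨ.tendsto.eventually hB] with x h3 h4
  rw [h3, h4]
  simp only [Matrix.transpose_mul, Matrix.mul_assoc]

theorem IsCongruentVia.symm (hΨ : IsDiffeoGerm k Ψ) (h : ∀ᶠ x in 𝓝 0, Φ (Ψ x) = x)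
    (h1 : IsCongruentVia k Φ A B) : IsCongruentVia k Ψ B A := by
  obtain ⟨X, hX, hB⟩ := h1
  have hXΨ := hX.comp hΨ.2.1 hΨ.1
  refine ⟨fun x => (X (Ψ x))⁻¹, hXΨ.inv, ?_⟩
  filter_upwards [h, hXΨ.2, hΨ.tendsto.eventually hB] with x h3 h4 h5
  have hu : IsUnit (X (Ψ x)).det := (Matrix.isUnit_iff_isUnit_det _).1 h4
  rw [h5, h3, Matrix.mul_assoc, Matrix.mul_assoc, Matrix.mul_assoc, Matrix.mul_nonsing_inv _ hu,
    Matrix.mul_one, ← Matrix.mul_assoc, ← Matrix.transpose_mul, Matrix.mul_nonsing_inv _ hu,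
    Matrix.transpose_one, Matrix.one_mul]

/-! ### Densities -/

/-- The diffeomorphism germ `Φ` pulls the density `f` back to the density `g`. -/
def TransportsDensity (Φ : (Fin r → ℝ) → (Fin r → ℝ)) (f g : (Fin r → ℝ) → ℝ) : Prop :=
  ∀ᶠ x in 𝓝 0, f (Φ x) * (fderiv ℝ Φ x).det = g x

variable {f g h : (Fin r → ℝ) → ℝ}

theorem TransportsDensity.trans (hk : k ≠ 0) (hΦ : IsDiffeoGerm k Φ) (hΨ : IsDiffeoGerm k Ψ)
    (h1 : TransportsDensity Φ f g) (h2 : TransportsDensity Ψ g h) :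
    TransportsDensity (fun x => Φ (Ψ x)) f h := by
  filter_upwards [h2, hΨ.tendsto.eventually h1, jacobian_comp hΦ.2.1 hΨ.2.1 hΨ.1 hk] with x h3 h4 h5
  rw [h5, ← h3, ← h4, mul_assoc]

theorem TransportsDensity.symm (hk : k ≠ 0) (hΦ : IsDiffeoGerm k Φ) (hΨ : IsDiffeoGerm k Ψ)
    (h : ∀ᶠ x in 𝓝 0, Φ (Ψ x) = x)
    (h1 : TransportsDensity Φ f g) : TransportsDensity Ψ g f := by
  filter_upwards [h, hΨ.tendsto.eventually h1, jacobian_comp hΦ.2.1 hΨ.2.1 hΨ.1 hk,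
    jacobian_of_eventually_eq_id h] with x h2 h3 h4 h5
  rw [← h3, h2, mul_assoc, ← h4, h5, mul_one]

/-- The coefficient of a top-degree form with respect to the standard volume form. -/
noncomputable def formDensity (Ω : (Fin r → ℝ) → (Fin r → ℝ) [⋀^Fin r]→L[ℝ] ℝ) :
    (Fin r → ℝ) → ℝ :=
  fun x => Ω x (Pi.basisFun ℝ (Fin r))

theorem topForm_ext {α β : (Fin r → ℝ) [⋀^Fin r]→L[ℝ] ℝ}
    (h : α (Pi.basisFun ℝ (Fin r)) = β (Pi.basisFun ℝ (Fin r))) : α = β := by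
  apply ContinuousAlternatingMap.toAlternatingMap_injective
  rw [α.toAlternatingMap.eq_smul_basis_det (Pi.basisFun ℝ (Fin r)),
    β.toAlternatingMap.eq_smul_basis_det (Pi.basisFun ℝ (Fin r))]
  congr 1

theorem formDensity_pullbackForm (Ω : (Fin r → ℝ) → (Fin r → ℝ) [⋀^Fin r]→L[ℝ] ℝ)
    (x : Fin r → ℝ) :
    formDensity (pullbackForm Φ Ω) x = formDensity Ω (Φ x) * (fderiv ℝ Φ x).det := by
  have h := congrArg (fun α => α (fun i => fderiv ℝ Φ x (Pi.basisFun ℝ (Fin r) i)))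
    ((Ω (Φ x)).toAlternatingMap.eq_smul_basis_det (Pi.basisFun ℝ (Fin r)))
  refine h.trans ?_
  have h2 := (Pi.basisFun ℝ (Fin r)).det_comp (fderiv ℝ Φ x).toLinearMap (Pi.basisFun ℝ (Fin r))
  rw [Module.Basis.det_self, mul_one] at h2
  exact congrArg _ h2

/-- Top-degree forms have a single coefficient, so the rest of the argument deals with scalar
densities. The determinant is signed, hence densities remember orientation. -/
theorem preservesForm_iff {Ω : (Fin r → ℝ) → (Fin r → ℝ) [⋀^Fin r]→L[ℝ] ℝ} :
    PreservesForm Ω Φ ↔ TransportsDensity Φ (formDensity Ω) (formDensity Ω) := by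
  refine eventually_congr (Eventually.of_forall fun x => ?_)
  rw [← formDensity_pullbackForm]
  exact ⟨fun h => by simp [formDensity, h], fun h => topForm_ext h⟩

theorem IsVolumeFormGerm.isRegularGerm_formDensity
    {Ω : (Fin r → ℝ) → (Fin r → ℝ) [⋀^Fin r]→L[ℝ] ℝ} (hΩ : IsVolumeFormGerm k Ω) :
    IsRegularGerm k (formDensity Ω) := by
  filter_upwards [hΩ.1] with x hx
  exact (ContinuousLinearMap.contDiff
    (ContinuousAlternatingMap.apply ℝ (Fin r → ℝ) ℝ (Pi.basisFun ℝ (Fin r)))).contDiffAt.comp x hx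

theorem IsVolumeFormGerm.formDensity_ne_zero
    {Ω : (Fin r → ℝ) → (Fin r → ℝ) [⋀^Fin r]→L[ℝ] ℝ} (hΩ : IsVolumeFormGerm k Ω) :
    formDensity Ω 0 ≠ 0 :=
  fun h => hΩ.2.self_of_nhds (topForm_ext h)

end DiffeoGerms

/-! ### Weighted dilations and weighted averages -/

section WeightedAverage

open MeasureTheory

variable {r : ℕ} {k : WithTop ℕ∞}

/-- The weighted dilation `x ↦ (t ^ w₁ x₁, …, t ^ w_r x_r)`. -/
noncomputable def weightedDilation (w : Fin r → ℕ) (t : ℝ) : (Fin r → ℝ) →L[ℝ] (Fin r → ℝ) :=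
  ContinuousLinearMap.pi fun l => t ^ w l • ContinuousLinearMap.proj l

/-- The average of `f` over the weighted dilations with parameter in `[0, 1]` and weight `h`. -/
noncomputable def weightedAverage (w : Fin r → ℕ) (h : ℝ → ℝ) (f : (Fin r → ℝ) → ℝ)
    (x : Fin r → ℝ) : ℝ :=
  ∫ t in (0 : ℝ)..1, h t * f (weightedDilation w t x)

variable (w : Fin r → ℕ)

@[simp] theorem weightedDilation_apply (t : ℝ) (x : Fin r → ℝ) (l : Fin r) :
    weightedDilation w t x l = t ^ w l * x l := rfl

@[simp] theorem weightedDilation_one (x : Fin r → ℝ) : weightedDilation w 1 x = x := by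
  ext l; simp

theorem weightedDilation_mul (s t : ℝ) (x : Fin r → ℝ) :
    weightedDilation w (s * t) x = weightedDilation w s (weightedDilation w t x) := by
  ext l; simp [mul_pow, mul_assoc]

theorem norm_weightedDilation_apply_le {t : ℝ} (h0 : 0 ≤ t) (h1 : t ≤ 1) (x : Fin r → ℝ) :
    ‖weightedDilation w t x‖ ≤ ‖x‖ := by
  refine (pi_norm_le_iff_of_nonneg (norm_nonneg _)).2 fun l => ?_
  rw [weightedDilation_apply, norm_mul, norm_pow, Real.norm_of_nonneg h0]
  calc t ^ w l * ‖x l‖ ≤ 1 * ‖x l‖ := by gcongr; exact pow_le_one₀ h0 h1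
    _ ≤ ‖x‖ := by rw [one_mul]; exact norm_le_pi_norm x l

theorem norm_weightedDilation_le {t : ℝ} (h0 : 0 ≤ t) (h1 : t ≤ 1) : ‖weightedDilation w t‖ ≤ 1 :=
  ContinuousLinearMap.opNorm_le_bound _ zero_le_one fun x => by
    rw [one_mul]; exact norm_weightedDilation_apply_le w h0 h1 x

theorem continuous_weightedDilation_uncurry :
    Continuous fun p : ℝ × (Fin r → ℝ) => weightedDilation w p.1 p.2 := by
  refine continuous_pi fun l => ?_
  simp only [weightedDilation_apply]
  fun_prop

theorem continuous_weightedDilation : Continuous (weightedDilation w) := by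
  rw [continuous_clm_apply]
  exact fun x => (continuous_weightedDilation_uncurry w).comp (Continuous.prodMk_left x)

theorem continuousOn_comp_weightedDilation {X : Type*} [TopologicalSpace X]
    {f : (Fin r → ℝ) → X} {ε : ℝ} (hf : ContinuousOn f (Metric.ball 0 ε)) :
    ContinuousOn (fun p : ℝ × (Fin r → ℝ) => f (weightedDilation w p.1 p.2))
      (Set.Icc 0 1 ×ˢ Metric.ball 0 ε) := by
  refine hf.comp (continuous_weightedDilation_uncurry w).continuousOn fun p hp => ?_
  rw [mem_ball_zero_iff]
  exact (norm_weightedDilation_apply_le w hp.1.1 hp.1.2 p.2).trans_lt (mem_ball_zero_iff.1 hp.2)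

/-- Differentiation under the integral sign. The partial derivatives are again weighted averages,
with weight multiplied by `t ^ w l`; arbitrary weights `h` are allowed so that this closes up under
induction. -/
theorem hasFDerivAt_weightedAverage {h : ℝ → ℝ} (hh : Continuous h) {f : (Fin r → ℝ) → ℝ} {ε : ℝ}
    (hf : ContDiffOn ℝ 1 f (Metric.ball 0 ε)) {x : Fin r → ℝ} (hx : x ∈ Metric.ball 0 ε) :
    HasFDerivAt (weightedAverage w h f)
      (∑ l, weightedAverage w (fun t => h t * t ^ w l) (fun y => fderiv ℝ f y (Pi.single l 1)) x •
        (ContinuousLinearMap.proj l : (Fin r → ℝ) →L[ℝ] ℝ)) x := by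
  obtain ⟨ρ, hxρ, hρ⟩ := exists_between (mem_ball_zero_iff.1 hx)
  have hsub : Metric.closedBall (0 : Fin r → ℝ) ρ ⊆ Metric.ball 0 ε :=
    Metric.closedBall_subset_ball hρ
  have hdf : ContinuousOn (fderiv ℝ f) (Metric.ball 0 ε) :=
    hf.continuousOn_fderiv_of_isOpen Metric.isOpen_ball le_rfl
  let f' : (Fin r → ℝ) → ℝ → (Fin r → ℝ) →L[ℝ] ℝ := fun y t =>
    ∑ l, (h t * t ^ w l * fderiv ℝ f (weightedDilation w t y) (Pi.single l 1)) •
      (ContinuousLinearMap.proj l : (Fin r → ℝ) →L[ℝ] ℝ)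
  have hpart : ∀ l, ContinuousOn (fun p : ℝ × (Fin r → ℝ) =>
      h p.1 * p.1 ^ w l * fderiv ℝ f (weightedDilation w p.1 p.2) (Pi.single l 1))
      (Set.Icc 0 1 ×ˢ Metric.ball 0 ε) := fun l =>
    ContinuousOn.mul (by fun_prop)
      ((continuousOn_comp_weightedDilation w hdf).clm_apply continuousOn_const)
  have hf'c : ContinuousOn (fun p : ℝ × (Fin r → ℝ) => f' p.2 p.1)
      (Set.Icc 0 1 ×ˢ Metric.ball 0 ε) :=
    continuousOn_finsetSum _ fun l _ => (hpart l).smul continuousOn_const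
  have hfc : ContinuousOn (fun p : ℝ × (Fin r → ℝ) => h p.1 * f (weightedDilation w p.1 p.2))
      (Set.Icc 0 1 ×ˢ Metric.ball 0 ε) :=
    ContinuousOn.mul (by fun_prop) (continuousOn_comp_weightedDilation w hf.continuousOn)
  have hslice : ∀ y ∈ Metric.ball (0 : Fin r → ℝ) ε,
      Set.MapsTo (fun t : ℝ => (t, y)) (Set.Icc 0 1) (Set.Icc 0 1 ×ˢ Metric.ball 0 ε) :=
    fun y hy t ht => ⟨ht, hy⟩
  have huI : Set.uIoc (0 : ℝ) 1 ⊆ Set.Icc 0 1 := by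
    rw [Set.uIoc_of_le zero_le_one]; exact Set.Ioc_subset_Icc_self
  have hFc : ∀ y ∈ Metric.ball (0 : Fin r → ℝ) ε,
      ContinuousOn (fun t => h t * f (weightedDilation w t y)) (Set.Icc 0 1) := fun y hy =>
    hfc.comp (by fun_prop) (hslice y hy)
  -- The dominating constant comes from compactness, which is why the smaller radius `ρ` was
  -- inserted.
  obtain ⟨C, hC⟩ := (isCompact_Icc.prod (isCompact_closedBall (0 : Fin r → ℝ) ρ)
    ).exists_bound_of_continuousOn (hf'c.mono (Set.prod_mono le_rfl hsub))
  have hs : Metric.ball (0 : Fin r → ℝ) ρ ∈ 𝓝 x :=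
    Metric.isOpen_ball.mem_nhds (mem_ball_zero_iff.2 hxρ)
  have key := intervalIntegral.hasFDerivAt_integral_of_dominated_of_fderiv_le (μ := volume)
    (a := 0) (b := 1) (F := fun y t => h t * f (weightedDilation w t y)) (F' := f')
    (bound := fun _ => C) hs ?_ ?_ ?_ ?_ ?_ ?_
  · refine key.congr_fderiv ?_
    simp only [f']
    rw [intervalIntegral.integral_finsetSum]
    · refine Finset.sum_congr rfl fun l _ => ?_
      rw [intervalIntegral.integral_smul_const]
      rfl
    · intro l _
      refine ContinuousOn.intervalIntegrable ?_
      rw [Set.uIcc_of_le zero_le_one]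
      exact ((hpart l).comp (by fun_prop) (hslice x hx)).smul continuousOn_const
  · filter_upwards [hs] with y hy
    exact ((hFc y (hsub (Metric.ball_subset_closedBall hy))).mono huI).aestronglyMeasurable
      measurableSet_uIoc
  · refine ContinuousOn.intervalIntegrable ?_
    rw [Set.uIcc_of_le zero_le_one]
    exact hFc x hx
  · exact ((hf'c.comp (by fun_prop) (hslice x hx)).mono huI).aestronglyMeasurable
      measurableSet_uIoc
  · exact Eventually.of_forall fun t ht y hy =>
      hC (t, y) ⟨huI ht, Metric.ball_subset_closedBall hy⟩
  · exact intervalIntegrable_const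
  · refine Eventually.of_forall fun t ht y hy => ?_
    have hy' : weightedDilation w t y ∈ Metric.ball (0 : Fin r → ℝ) ε := by
      rw [mem_ball_zero_iff]
      exact (norm_weightedDilation_apply_le w (huI ht).1 (huI ht).2 y).trans_lt
        ((mem_ball_zero_iff.1 hy).trans hρ)
    have h1 : HasFDerivAt f (fderiv ℝ f (weightedDilation w t y)) (weightedDilation w t y) :=
      ((hf.contDiffAt (Metric.isOpen_ball.mem_nhds hy')).differentiableAt one_ne_zero).hasFDerivAt
    refine ((h1.comp y (weightedDilation w t).hasFDerivAt).const_mul (h t)).congr_fderiv ?_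
    refine ContinuousLinearMap.ext fun v => ?_
    have hv : weightedDilation w t v = ∑ l, (t ^ w l * v l) • Pi.single l (1 : ℝ) := by
      ext i
      simp [Finset.sum_apply, Pi.single_apply]
    simp only [f', smul_apply, ContinuousLinearMap.comp_apply, hv, map_sum,
      map_smul, sum_apply, ContinuousLinearMap.proj_apply, smul_eq_mul,
      Finset.mul_sum]
    exact Finset.sum_congr rfl fun l _ => by ring

theorem contDiffOn_weightedAverage (m : ℕ) {h : ℝ → ℝ} (hh : Continuous h)
    {f : (Fin r → ℝ) → ℝ} {ε : ℝ} (hf : ContDiffOn ℝ ∞ f (Metric.ball 0 ε)) :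
    ContDiffOn ℝ m (weightedAverage w h f) (Metric.ball 0 ε) := by
  induction m generalizing h f with
  | zero =>
    refine contDiffOn_zero.2 fun x hx => ?_
    exact (hasFDerivAt_weightedAverage w hh (hf.of_le (by simp)) hx
      ).continuousAt.continuousWithinAt
  | succ m ih =>
    have hd := fun x (hx : x ∈ Metric.ball 0 ε) =>
      hasFDerivAt_weightedAverage w hh (hf.of_le (by simp)) hx
    push_cast
    rw [contDiffOn_succ_iff_fderiv_of_isOpen Metric.isOpen_ball]
    refine ⟨fun x hx => (hd x hx).differentiableAt.differentiableWithinAt, by simp, ?_⟩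
    refine ContDiffOn.congr ?_ fun x hx => (hd x hx).fderiv
    refine ContDiffOn.sum fun l _ => ContDiffOn.smul (ih (by fun_prop) ?_) contDiffOn_const
    exact ((contDiffOn_infty_iff_fderiv_of_isOpen Metric.isOpen_ball).1 hf).2.clm_apply
      contDiffOn_const

/-- The power series is averaged term by term. As `D_t` has norm at most 1 for `t` in `[0, 1]`, the
averaged coefficients are bounded by a constant times the original ones, and no radius is lost. -/
theorem analyticAt_weightedAverage {h : ℝ → ℝ} (hh : Continuous h)
    {f : (Fin r → ℝ) → ℝ} (hf : AnalyticAt ℝ f 0) :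
    AnalyticAt ℝ (weightedAverage w h f) 0 := by
  obtain ⟨p, R, hp⟩ := hf
  obtain ⟨C, hC⟩ := isCompact_Icc.exists_bound_of_continuousOn
    (s := Set.Icc (0 : ℝ) 1) (f := h) hh.continuousOn
  have huI : Set.uIoc (0 : ℝ) 1 ⊆ Set.Icc 0 1 := by
    rw [Set.uIoc_of_le zero_le_one]; exact Set.Ioc_subset_Icc_self
  have hC0 : 0 ≤ C := (norm_nonneg _).trans (hC 0 (by simp))
  let P : ∀ n, ℝ → ContinuousMultilinearMap ℝ (fun _ : Fin n => Fin r → ℝ) ℝ := fun n t =>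
    h t • (p n).compContinuousLinearMap fun _ => weightedDilation w t
  have hPc : ∀ n, Continuous (P n) := by
    intro n
    refine hh.smul ?_
    have h1 := (ContinuousMultilinearMap.compContinuousLinearMapContinuousMultilinear ℝ
      (fun _ : Fin n => Fin r → ℝ) (fun _ : Fin n => Fin r → ℝ) ℝ).cont
    have h2 : Continuous fun t : ℝ => fun _ : Fin n => weightedDilation w t :=
      continuous_pi fun _ => continuous_weightedDilation w
    exact (h1.comp h2).clm_apply continuous_const
  have hPb : ∀ n, ∀ t ∈ Set.Icc (0 : ℝ) 1, ‖P n t‖ ≤ C * ‖p n‖ := by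
    intro n t ht
    rw [norm_smul]
    refine mul_le_mul (hC t ht) ?_ (norm_nonneg _) hC0
    refine ((p n).norm_compContinuousLinearMap_le _).trans ?_
    refine mul_le_of_le_one_right (norm_nonneg _) ?_
    exact Finset.prod_le_one (fun _ _ => norm_nonneg _)
      fun _ _ => norm_weightedDilation_le w ht.1 ht.2
  let q : FormalMultilinearSeries ℝ (Fin r → ℝ) ℝ := fun n => ∫ t in (0 : ℝ)..1, P n t
  have hqb : ∀ n, ‖q n‖ ≤ C * ‖p n‖ := by
    intro n
    refine (intervalIntegral.norm_integral_le_of_norm_le_const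
      fun t ht => hPb n t (huI ht)).trans ?_
    simp
  have hq : ∀ n (v : Fin n → Fin r → ℝ), q n v = ∫ t in (0 : ℝ)..1, P n t v := by
    intro n v
    exact ((ContinuousMultilinearMap.apply ℝ (fun _ : Fin n => Fin r → ℝ) ℝ v
      ).intervalIntegral_comp_comm ((hPc n).intervalIntegrable 0 1)).symm
  refine ⟨q, R, ?_, hp.r_pos, ?_⟩
  · refine hp.r_le.trans (ENNReal.le_of_forall_nnreal_lt fun ρ hρ => ?_)
    obtain ⟨K, -, hK⟩ := p.norm_mul_pow_le_of_lt_radius hρ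
    refine q.le_radius_of_bound (C * K) fun n => ?_
    calc ‖q n‖ * (ρ : ℝ) ^ n ≤ C * ‖p n‖ * (ρ : ℝ) ^ n := by gcongr; exact hqb n
      _ = C * (‖p n‖ * (ρ : ℝ) ^ n) := by ring
      _ ≤ C * K := by gcongr; exact hK n
  · intro y hy
    simp only [hq, zero_add]
    have hsum : Summable fun n => C * (‖p n‖ * ‖y‖ ^ n) := by
      refine Summable.mul_left C ?_
      have : ((‖y‖₊ : NNReal) : ENNReal) < p.radius := by
        refine lt_of_lt_of_le ?_ hp.r_le
        simpa [enorm_eq_nnnorm] using hy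
      exact p.summable_norm_mul_pow this
    have hD : ∀ t ∈ Set.Icc (0 : ℝ) 1, weightedDilation w t y ∈ Metric.eball 0 R := by
      intro t ht
      have h1 : ‖weightedDilation w t y‖₊ ≤ ‖y‖₊ :=
        norm_weightedDilation_apply_le w ht.1 ht.2 y
      rw [mem_eball_zero_iff] at hy ⊢
      refine lt_of_le_of_lt ?_ hy
      simpa [enorm_eq_nnnorm] using h1
    refine intervalIntegral.hasSum_integral_of_dominated_convergence
      (fun n _ => C * (‖p n‖ * ‖y‖ ^ n)) ?_ ?_ ?_ ?_ ?_
    · intro n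
      have : Continuous fun t => P n t fun _ => y :=
        (ContinuousMultilinearMap.apply ℝ (fun _ : Fin n => Fin r → ℝ) ℝ fun _ => y
          ).continuous.comp (hPc n)
      exact this.aestronglyMeasurable
    · intro n
      refine Eventually.of_forall fun t ht => ?_
      refine ((P n t).le_opNorm _).trans ?_
      rw [Finset.prod_const, Finset.card_univ, Fintype.card_fin, ← mul_assoc]
      gcongr
      exact hPb n t (huI ht)
    · exact Eventually.of_forall fun _ _ => hsum
    · exact intervalIntegrable_const
    · refine Eventually.of_forall fun t ht => ?_
      have := (hp.hasSum (hD t (huI ht))).mul_left (h t)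
      simpa [P] using this

theorem isRegularGerm_weightedAverage (hk : k = ∞ ∨ k = ω) {h : ℝ → ℝ} (hh : Continuous h)
    {f : (Fin r → ℝ) → ℝ} (hf : IsRegularGerm k f) :
    IsRegularGerm k (weightedAverage w h f) := by
  rcases hk with rfl | rfl
  · obtain ⟨ε, hε, hball⟩ := Metric.eventually_nhds_iff_ball.1 hf
    filter_upwards [Metric.ball_mem_nhds 0 hε] with x hx
    have : ContDiffOn ℝ ∞ (weightedAverage w h f) (Metric.ball 0 ε) :=
      contDiffOn_infty.2 fun m => contDiffOn_weightedAverage w m hh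
        fun y hy => (hball y hy).contDiffWithinAt
    exact this.contDiffAt (Metric.isOpen_ball.mem_nhds hx)
  · filter_upwards [(analyticAt_weightedAverage w hh
      hf.contDiffAt.analyticAt).eventually_analyticAt] with x hx
    exact hx.contDiffAt

/-- Substitution `u = t τ`. Along an orbit of the dilations the average becomes a primitive, ready
to be differentiated in `τ`. -/
theorem weightedAverage_weightedDilation (Λ : ℕ) (f : (Fin r → ℝ) → ℝ) (x : Fin r → ℝ) (τ : ℝ) :
    τ ^ (Λ + 1) * weightedAverage w (fun t => (Λ + 1) * t ^ Λ) f (weightedDilation w τ x) =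
      ∫ u in (0 : ℝ)..τ, (Λ + 1) * u ^ Λ * f (weightedDilation w u x) := by
  have h := intervalIntegral.mul_integral_comp_mul_right (a := 0) (b := 1) (c := τ)
    (f := fun u => (Λ + 1) * u ^ Λ * f (weightedDilation w u x))
  rw [zero_mul, one_mul] at h
  rw [← h, weightedAverage, pow_succ', mul_assoc, ← intervalIntegral.integral_const_mul]
  congr 2
  ext t
  rw [weightedDilation_mul, mul_pow]
  ring

/-- The derivative at `τ = 1` of both sides of `weightedAverage_weightedDilation`: product and chain
rule on the left, fundamental theorem of calculus on the right. -/
theorem euler_weightedAverage (Λ : ℕ) {f : (Fin r → ℝ) → ℝ} {ε : ℝ}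
    (hf : ContinuousOn f (Metric.ball 0 ε)) {x : Fin r → ℝ} (hx : x ∈ Metric.ball 0 ε)
    (hd : DifferentiableAt ℝ (weightedAverage w (fun t => (Λ + 1) * t ^ Λ) f) x) :
    (Λ + 1) * weightedAverage w (fun t => (Λ + 1) * t ^ Λ) f x +
      fderiv ℝ (weightedAverage w (fun t => (Λ + 1) * t ^ Λ) f) x (fun l => w l * x l) =
      (Λ + 1) * f x := by
  set F := weightedAverage w (fun t => (Λ + 1) * t ^ Λ) f with hF
  have hDc : Continuous fun t => weightedDilation w t x :=
    (continuous_weightedDilation_uncurry w).comp (Continuous.prodMk_left x)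
  -- An open set of parameters containing `[0, 1]`: the integrand must be continuous on both sides
  -- of the endpoint `1`.
  set U := (fun t => weightedDilation w t x) ⁻¹' Metric.ball 0 ε with hU
  have hUo : IsOpen U := Metric.isOpen_ball.preimage hDc
  have hIU : Set.Icc 0 1 ⊆ U := fun t ht => by
    rw [hU, Set.mem_preimage, mem_ball_zero_iff]
    exact (norm_weightedDilation_apply_le w ht.1 ht.2 x).trans_lt (mem_ball_zero_iff.1 hx)
  have hg : ContinuousOn (fun u : ℝ => (Λ + 1) * u ^ Λ * f (weightedDilation w u x)) U :=
    ContinuousOn.mul (by fun_prop) (hf.comp hDc.continuousOn fun t ht => ht)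
  have hga : ∀ u ∈ U, ContinuousAt
      (fun u : ℝ => (Λ + 1) * u ^ Λ * f (weightedDilation w u x)) u :=
    fun u hu => hg.continuousAt (hUo.mem_nhds hu)
  have h1U : (1 : ℝ) ∈ U := hIU (by simp)
  have h1 : HasDerivAt (fun τ => ∫ u in (0 : ℝ)..τ, (Λ + 1) * u ^ Λ * f (weightedDilation w u x))
      ((Λ + 1) * 1 ^ Λ * f (weightedDilation w 1 x)) 1 := by
    refine intervalIntegral.integral_hasDerivAt_right ?_
      (ContinuousAt.stronglyMeasurableAtFilter hUo hga 1 h1U) (hga 1 h1U)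
    refine ContinuousOn.intervalIntegrable (hg.mono ?_)
    rwa [Set.uIcc_of_le zero_le_one]
  have h2 : HasDerivAt (fun τ : ℝ => weightedDilation w τ x) (fun l => w l * x l) 1 := by
    refine hasDerivAt_pi.2 fun l => ?_
    simpa using (hasDerivAt_pow (w l) (1 : ℝ)).mul_const (x l)
  have h3 : HasDerivAt (fun τ : ℝ => F (weightedDilation w τ x))
      (fderiv ℝ F x fun l => w l * x l) 1 := by
    have hd1 : HasFDerivAt F (fderiv ℝ F x) (weightedDilation w 1 x) := by
      rw [weightedDilation_one]
      exact hd.hasFDerivAt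
    exact hd1.comp_hasDerivAt 1 h2
  have h4 : HasDerivAt (fun τ : ℝ => τ ^ (Λ + 1) * F (weightedDilation w τ x))
      ((Λ + 1) * F x + fderiv ℝ F x fun l => w l * x l) 1 := by
    refine ((hasDerivAt_pow (Λ + 1) (1 : ℝ)).mul h3).congr_deriv ?_
    simp
  simp only [hF, weightedAverage_weightedDilation] at h4
  have h6 := h4.unique h1
  rw [hF, h6, one_pow, weightedDilation_one, mul_one]

end WeightedAverage

/-! ### Dilations with variable parameter -/

section VariableDilation

variable {r : ℕ} {k : WithTop ℕ∞} (w : Fin r → ℕ)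

theorem IsRegularGerm.weightedDilation {s : (Fin r → ℝ) → ℝ} (hs : IsRegularGerm k s) :
    IsRegularGerm k (fun x => weightedDilation w (s x) x) :=
  isRegularGerm_pi.2 fun l => (hs.pow (w l)).mul
    (isRegularGerm_of_contDiff (contDiff_apply ℝ ℝ l))

theorem det_weightedDilation (t : ℝ) : (weightedDilation w t).det = t ^ ∑ l, w l := by
  have : (weightedDilation w t).toLinearMap =
      Matrix.toLin' (Matrix.diagonal fun l => t ^ w l) := by
    ext x l
    simp [Matrix.mulVec_diagonal]
  rw [ContinuousLinearMap.det, this, LinearMap.det_toLin', Matrix.det_diagonal,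
    Finset.prod_pow_eq_pow_sum]

/-- The differential is `D_s ∘ (id + ds ⊗ u)` with `u = s⁻¹ (w_l x_l)`, a dilation after a rank-one
perturbation of the identity. -/
theorem jacobian_weightedDilation {s : (Fin r → ℝ) → ℝ} {x : Fin r → ℝ}
    (hs : DifferentiableAt ℝ s x) (h0 : s x ≠ 0) :
    (fderiv ℝ (fun x => weightedDilation w (s x) x) x).det =
      s x ^ (∑ l, w l) * (1 + (s x)⁻¹ * fderiv ℝ s x fun l => w l * x l) := by
  let u : Fin r → ℝ := (s x)⁻¹ • fun l => w l * x l
  have hd : HasFDerivAt (fun x => weightedDilation w (s x) x)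
      ((weightedDilation w (s x)).comp
        (ContinuousLinearMap.id ℝ _ + (fderiv ℝ s x).smulRight u)) x := by
    refine hasFDerivAt_pi'.2 fun l => ?_
    have h1 := (hs.hasFDerivAt.pow (w l)).mul
      (ContinuousLinearMap.proj (R := ℝ) (φ := fun _ : Fin r => ℝ) l).hasFDerivAt (x := x)
    refine h1.congr_fderiv (ContinuousLinearMap.ext fun v => ?_)
    rcases Nat.eq_zero_or_pos (w l) with hw | hw
    · simp [hw, u]
    · obtain ⟨m, hm⟩ := Nat.exists_eq_succ_of_ne_zero hw.ne'
      simp [hm, u]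
      field_simp
      ring
  rw [hd.fderiv]
  have h2 : ((weightedDilation w (s x)).comp
      (ContinuousLinearMap.id ℝ _ + (fderiv ℝ s x).smulRight u)).det =
      (weightedDilation w (s x)).det *
        LinearMap.det (LinearMap.transvection (fderiv ℝ s x).toLinearMap u) :=
    LinearMap.det_comp _ _
  rw [h2, det_weightedDilation, LinearMap.transvection.det]
  simp only [u, map_smul, smul_eq_mul, ContinuousLinearMap.coe_coe]

/-- Every positive density is the Jacobian of a dilation with variable parameter. -/
theorem exists_weightedDilation_jacobian_eq (hk : k = ∞ ∨ k = ω) (hw : 0 < ∑ l, w l)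
    {f : (Fin r → ℝ) → ℝ} (hf : IsRegularGerm k f) (hf0 : 0 < f 0) :
    ∃ s : (Fin r → ℝ) → ℝ, IsRegularGerm k s ∧ 0 < s 0 ∧
      ∀ᶠ x in 𝓝 0, (fderiv ℝ (fun x => weightedDilation w (s x) x) x).det = f x := by
  -- `Λ + 1` is the total weight. In `F = s ^ (Λ + 1)` the Jacobian equation is linear, and
  -- `euler_weightedAverage` says that the average of `f` solves it.
  obtain ⟨Λ, hΛ⟩ := Nat.exists_eq_succ_of_ne_zero hw.ne'
  have hk0 := ne_zero_of_smooth_or_analytic hk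
  have hΛ0 : (Λ + 1 : ℝ) ≠ 0 := by positivity
  set F := weightedAverage w (fun t => (Λ + 1) * t ^ Λ) f
  have hF : IsRegularGerm k F := isRegularGerm_weightedAverage w hk (by fun_prop) hf
  have heuler : ∀ᶠ x in 𝓝 0,
      (Λ + 1) * F x + fderiv ℝ F x (fun l => w l * x l) = (Λ + 1) * f x := by
    obtain ⟨ε, hε, hball⟩ := Metric.eventually_nhds_iff_ball.1 hf
    filter_upwards [Metric.ball_mem_nhds 0 hε, hF.eventually_differentiableAt hk0] with x hx hd
    exact euler_weightedAverage w Λ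
      (fun y hy => (hball y hy).continuousAt.continuousWithinAt) hx hd
  have hF0 : F 0 = f 0 := by
    have h := heuler.self_of_nhds
    have hz : (fun l => (w l : ℝ) * (0 : Fin r → ℝ) l) = 0 := by ext; simp
    rw [hz, map_zero, add_zero] at h
    exact mul_left_cancel₀ hΛ0 h
  have hFpos : ∀ᶠ x in 𝓝 0, 0 < F x :=
    hF.contDiffAt.continuousAt.eventually (lt_mem_nhds (hF0 ▸ hf0))
  obtain ⟨s, hs_eq⟩ : ∃ s : (Fin r → ℝ) → ℝ, s = fun x => F x ^ (Λ + 1 : ℝ)⁻¹ := ⟨_, rfl⟩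
  have hs : IsRegularGerm k s := hs_eq ▸ hF.rpow_const (hF0 ▸ hf0.ne') (Λ + 1 : ℝ)⁻¹
  have hspos : ∀ x, 0 < F x → 0 < s x := fun x hx => by
    rw [hs_eq]
    exact Real.rpow_pos_of_pos hx _
  refine ⟨s, hs, hspos 0 (hF0 ▸ hf0), ?_⟩
  filter_upwards [heuler, hFpos.eventually_nhds, hs.eventually_differentiableAt hk0]
    with x he hpos hd
  have hpow : (fun y => s y ^ (Λ + 1)) =ᶠ[𝓝 x] F := by
    filter_upwards [hpos] with y hy
    have := Real.rpow_inv_natCast_pow hy.le (Nat.succ_ne_zero Λ)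
    push_cast at this
    rw [hs_eq]
    exact this
  have hsx : s x ≠ 0 := (hspos x hpos.self_of_nhds).ne'
  have hdF : fderiv ℝ F x = ((Λ + 1 : ℕ) * s x ^ Λ) • fderiv ℝ s x := by
    rw [← hpow.fderiv_eq]
    refine ((hd.hasFDerivAt.pow (Λ + 1)).congr_fderiv ?_).fderiv
    ext v
    simp
  rw [jacobian_weightedDilation w hd hsx, hΛ]
  rw [hdF, ← hpow.self_of_nhds] at he
  simp only [smul_apply, smul_eq_mul] at he
  push_cast at he
  refine mul_left_cancel₀ hΛ0 (Eq.trans ?_ he)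
  rw [Nat.succ_eq_add_one, pow_succ]
  field_simp

end VariableDilation

/-! ### Quasi-homogeneity with variable parameter -/

section QuasiHomogeneous

variable {r n : ℕ} {k : WithTop ℕ∞} (w : Fin r → ℕ)

/-- Quasi-homogeneity of a continuous germ for each parameter separately holds on a common
neighbourhood for all parameters in `(0, 1]`. -/
theorem exists_ball_quasiHomogeneous {b : (Fin r → ℝ) → ℝ} (hb : ∀ᶠ x in 𝓝 0, ContinuousAt b x)
    {p : ℝ} (h : ∀ t : ℝ, 0 < t → ∀ᶠ x in 𝓝 0, b (weightedDilation w t x) = t ^ p * b x) :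
    ∃ ε > 0, ∀ t : ℝ, 0 < t → t ≤ 1 → ∀ x ∈ Metric.ball 0 ε,
      b (weightedDilation w t x) = t ^ p * b x := by
  obtain ⟨ε₀, hε₀, hball⟩ := Metric.eventually_nhds_iff_ball.1 hb
  have hbc : ContinuousOn b (Metric.ball 0 ε₀) := fun y hy => (hball y hy).continuousWithinAt
  -- Baire category on the parameter line. Writing `t = exp (-|u|)` covers all of `(0, 1]` by the
  -- complete space `ℝ` and keeps every dilation contracting.
  let T : ℕ → Set ℝ := fun m => {u | ∀ x ∈ Metric.ball (0 : Fin r → ℝ) (ε₀ / (m + 1)),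
    b (weightedDilation w (Real.exp (-|u|)) x) = Real.exp (-|u|) ^ p * b x}
  have hsub : ∀ m : ℕ, Metric.ball (0 : Fin r → ℝ) (ε₀ / (m + 1)) ⊆ Metric.ball 0 ε₀ := fun m =>
    Metric.ball_subset_ball (div_le_self hε₀.le (by norm_num))
  have hexp : ∀ v : ℝ, 0 ≤ v → Real.exp (-v) ≤ 1 := fun v hv => Real.exp_le_one_iff.2 (by linarith)
  have hclosed : ∀ m, IsClosed (T m) := by
    intro m
    simp only [T, Set.ofPred_forall]
    refine isClosed_biInter fun x hx => isClosed_eq ?_ ?_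
    · refine (continuousOn_comp_weightedDilation w hbc).comp_continuous
        (f := fun u : ℝ => (Real.exp (-|u|), x)) (by fun_prop) fun u => ?_
      exact ⟨⟨(Real.exp_pos _).le, hexp _ (abs_nonneg u)⟩, hsub m hx⟩
    · refine Continuous.mul ?_ continuous_const
      exact Continuous.rpow_const (by fun_prop) fun u => Or.inl (Real.exp_pos _).ne'
  have hunion : ⋃ m, T m = Set.univ := by
    refine Set.eq_univ_of_forall fun u => Set.mem_iUnion.2 ?_
    obtain ⟨η, hη, hηb⟩ := Metric.eventually_nhds_iff_ball.1 (h _ (Real.exp_pos (-|u|)))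
    obtain ⟨m, hm⟩ := exists_nat_gt (ε₀ / η)
    refine ⟨m, fun x hx => hηb x (Metric.ball_subset_ball ?_ hx)⟩
    rw [div_lt_iff₀ hη] at hm
    rw [div_le_iff₀ (by positivity)]
    nlinarith
  obtain ⟨m, u, hu⟩ := nonempty_interior_of_iUnion_of_closed hclosed hunion
  obtain ⟨η, hη, hηT⟩ := Metric.mem_nhds_iff.1 (mem_interior_iff_mem_nhds.1 hu)
  set ε := ε₀ / (m + 1) with hε
  let Q : ℝ → Prop := fun v => ∀ x ∈ Metric.ball (0 : Fin r → ℝ) ε,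
    b (weightedDilation w (Real.exp (-v)) x) = Real.exp (-v) ^ p * b x
  have hmaps : ∀ v : ℝ, 0 ≤ v → ∀ x ∈ Metric.ball (0 : Fin r → ℝ) ε,
      weightedDilation w (Real.exp (-v)) x ∈ Metric.ball 0 ε := by
    intro v hv x hx
    rw [mem_ball_zero_iff] at hx ⊢
    exact (norm_weightedDilation_apply_le w (Real.exp_pos _).le (hexp v hv) x).trans_lt hx
  have hadd : ∀ v v' : ℝ, Real.exp (-(v + v')) = Real.exp (-v) * Real.exp (-v') := by
    intro v v'
    rw [← Real.exp_add]
    ring_nf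
  -- Moving away from `0` on the side of `u` increases the absolute value, so the interval around
  -- `u` yields all exponents in `[|u|, |u| + η)`.
  have hQ0 : ∀ d : ℝ, 0 ≤ d → d < η → Q (|u| + d) := by
    intro d hd hdη
    rcases le_total 0 u with h0 | h0
    · have : u + d ∈ T m := hηT (by simpa [abs_of_nonneg hd] using hdη)
      simp only [T, Set.mem_ofPred_eq] at this
      rw [abs_of_nonneg (add_nonneg h0 hd)] at this
      rw [abs_of_nonneg h0]
      exact this
    · have : u - d ∈ T m := hηT (by simpa [dist_eq_norm, abs_of_nonneg hd] using hdη)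
      simp only [T, Set.mem_ofPred_eq] at this
      rw [abs_of_nonpos (by linarith), show -(u - d) = -u + d by ring] at this
      rw [abs_of_nonpos h0]
      exact this
  -- Comparing the relation for `|u| + d` at `x` with that for `|u|` at the dilated point cancels
  -- the shift `|u|`.
  have hQsmall : ∀ d : ℝ, 0 ≤ d → d < η → Q d := by
    intro d hd hdη x hx
    have h1 := hQ0 0 le_rfl hη _ (hmaps d hd x hx)
    have h2 := hQ0 d hd hdη x hx
    rw [add_zero] at h1
    rw [hadd, weightedDilation_mul, h1, Real.mul_rpow (Real.exp_pos _).le (Real.exp_pos _).le,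
      mul_assoc] at h2
    exact mul_left_cancel₀ (Real.rpow_pos_of_pos (Real.exp_pos _) p).ne' h2
  -- Small exponents generate all non-negative ones, and the ball is stable under contraction, so it
  -- never shrinks.
  have hQnat : ∀ (N : ℕ) (d : ℝ), 0 ≤ d → d < η → Q (N * d) := by
    intro N d hd hdη
    induction N with
    | zero => exact hQsmall _ (by simp) (by simpa using hη)
    | succ N ih =>
      intro x hx
      have h1 := ih _ (hmaps d hd x hx)
      rw [hQsmall d hd hdη x hx, ← weightedDilation_mul, ← hadd, ← mul_assoc,
        ← Real.mul_rpow (Real.exp_pos _).le (Real.exp_pos _).le, ← hadd] at h1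
      push_cast
      rw [add_mul, one_mul]
      exact h1
  refine ⟨ε, by positivity, fun t ht0 ht1 x hx => ?_⟩
  have hv : 0 ≤ -Real.log t := neg_nonneg.2 (Real.log_nonpos ht0.le ht1)
  obtain ⟨N, hN⟩ := exists_nat_gt (-Real.log t / η)
  have hN0 : (0 : ℝ) < N := (div_nonneg hv hη.le).trans_lt hN
  have := hQnat N (-Real.log t / N) (div_nonneg hv hN0.le)
    ((div_lt_comm₀ hη hN0).1 hN) x hx
  rwa [mul_div_cancel₀ _ hN0.ne', neg_neg, Real.exp_log ht0] at this

theorem eventually_quasiHomogeneous {b : (Fin r → ℝ) → ℝ} (hb : ∀ᶠ x in 𝓝 0, ContinuousAt b x)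
    {p : ℝ} (h : ∀ t : ℝ, 0 < t → ∀ᶠ x in 𝓝 0, b (weightedDilation w t x) = t ^ p * b x)
    {s : (Fin r → ℝ) → ℝ} (hs : ContinuousAt s 0) (hs0 : 0 < s 0) :
    ∀ᶠ x in 𝓝 0, b (weightedDilation w (s x) x) = s x ^ p * b x := by
  obtain ⟨ε, hε, hball⟩ := exists_ball_quasiHomogeneous w hb h
  have hc : ContinuousAt (fun x => weightedDilation w (s x) x) 0 :=
    ContinuousAt.comp (f := fun x => (s x, x)) (g := fun p => weightedDilation w p.1 p.2)
      (continuous_weightedDilation_uncurry w).continuousAt (hs.prodMk continuousAt_id)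
  have hc' : ∀ᶠ x in 𝓝 0, weightedDilation w (s x) x ∈ Metric.ball 0 ε :=
    hc.preimage_mem_nhds (by simpa using Metric.ball_mem_nhds 0 hε)
  filter_upwards [Metric.ball_mem_nhds 0 hε, hc', hs.eventually (lt_mem_nhds hs0)]
    with x hx hDx hsx
  rcases le_total (s x) 1 with h1 | h1
  · exact hball _ hsx h1 x hx
  -- For `s x > 1` the relation with parameter `(s x)⁻¹` is applied at the dilated point and
  -- inverted.
  · have h2 := hball _ (inv_pos.2 hsx) (inv_le_one_of_one_le₀ h1) _ hDx
    rw [← weightedDilation_mul, inv_mul_cancel₀ hsx.ne', weightedDilation_one,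
      Real.inv_rpow hsx.le] at h2
    have h3 := (Real.rpow_pos_of_pos hsx p).ne'
    rw [h2, mul_inv_cancel_left₀ h3]

/-- The diagonal matrix with entries `s ^ (-δ_i / 2)` undoes the factor `s ^ ((δ_i + δ_j) / 2)`;
positivity of `s` makes the half-integral powers regular. -/
theorem isCongruentVia_weightedDilation {δ : Fin n → ℕ}
    {B : (Fin r → ℝ) → Matrix (Fin n) (Fin n) ℝ}
    (hB : ∀ i j, ∀ᶠ x in 𝓝 0, ContinuousAt (fun x => B x i j) x)
    (h : ∀ (t : ℝ), 0 < t → ∀ i j : Fin n, ∀ᶠ x in 𝓝 (0 : Fin r → ℝ),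
      B (weightedDilation w t x) i j = t ^ (((δ i : ℝ) + (δ j : ℝ)) / 2) * B x i j)
    {s : (Fin r → ℝ) → ℝ} (hs : IsRegularGerm k s) (hs0 : 0 < s 0) :
    IsCongruentVia k (fun x => weightedDilation w (s x) x) B B := by
  have hpos : ∀ᶠ x in 𝓝 0, 0 < s x :=
    hs.contDiffAt.continuousAt.eventually (lt_mem_nhds hs0)
  refine ⟨fun x => Matrix.diagonal fun i => s x ^ (-(δ i : ℝ) / 2), ⟨fun i j => ?_, ?_⟩, ?_⟩
  · by_cases hij : i = j
    · subst hij
      simpa using hs.rpow_const hs0.ne' _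
    · simpa [hij] using isRegularGerm_const (0 : ℝ)
  · filter_upwards [hpos] with x hx
    rw [Matrix.isUnit_iff_isUnit_det, Matrix.det_diagonal, isUnit_iff_ne_zero]
    exact Finset.prod_ne_zero_iff.2 fun i _ => (Real.rpow_pos_of_pos hx _).ne'
  · have : ∀ᶠ x in 𝓝 0, ∀ i j, B (weightedDilation w (s x) x) i j =
        s x ^ (((δ i : ℝ) + (δ j : ℝ)) / 2) * B x i j :=
      eventually_all.2 fun i => eventually_all.2 fun j =>
        eventually_quasiHomogeneous w (hB i j) (fun t ht => h t ht i j)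
          hs.contDiffAt.continuousAt hs0
    filter_upwards [this, hpos] with x hx hsx
    ext i j
    rw [Matrix.diagonal_transpose, Matrix.mul_diagonal, Matrix.diagonal_mul, hx i j]
    have h1 : s x ^ (-(δ i : ℝ) / 2) * s x ^ (((δ i : ℝ) + (δ j : ℝ)) / 2) *
        s x ^ (-(δ j : ℝ) / 2) = 1 := by
      rw [← Real.rpow_add hsx, ← Real.rpow_add hsx]
      convert Real.rpow_zero (s x) using 2
      ring
    calc B x i j = 1 * B x i j := (one_mul _).symm
      _ = _ := by rw [← h1]; ring

end QuasiHomogeneous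

/-! ### Transitivity of the isotropy group on densities -/

section Transitivity

variable {r n : ℕ} {k : WithTop ℕ∞}

/-- Two densities of the same sign are related by a dilation with variable parameter followed by
the inverse of another one. -/
theorem exists_transportsDensity_of_quasiHomogeneous (hk : k = ∞ ∨ k = ω) {w : Fin r → ℕ}
    (hw : 0 < ∑ l, w l) {δ : Fin n → ℕ} {B : (Fin r → ℝ) → Matrix (Fin n) (Fin n) ℝ}
    (hB : ∀ i j, ∀ᶠ x in 𝓝 0, ContinuousAt (fun x => B x i j) x)
    (h : ∀ (t : ℝ), 0 < t → ∀ i j : Fin n, ∀ᶠ x in 𝓝 (0 : Fin r → ℝ),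
      B (weightedDilation w t x) i j = t ^ (((δ i : ℝ) + (δ j : ℝ)) / 2) * B x i j)
    {f g : (Fin r → ℝ) → ℝ} (hf : IsRegularGerm k f) (hg : IsRegularGerm k g)
    (hfg : 0 < f 0 * g 0) :
    ∃ θ ∈ isotropyGroup k B, TransportsDensity θ f g := by
  have hk0 := ne_zero_of_smooth_or_analytic hk
  have hf0 : f 0 ≠ 0 := left_ne_zero_of_mul hfg.ne'
  -- Both densities are compared with the constant `f 0`: a variable dilation with Jacobian `e / f
  -- 0`, positive at `0`, pulls that constant back to `e`.
  have key : ∀ e : (Fin r → ℝ) → ℝ, IsRegularGerm k e → 0 < f 0 * e 0 →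
      ∃ θ ∈ isotropyGroup k B, TransportsDensity θ (fun _ => f 0) e := by
    intro e he he0
    obtain ⟨s, hs, hs0, hdet⟩ := exists_weightedDilation_jacobian_eq w hk hw
      (f := fun x => (f 0)⁻¹ * e x) ((isRegularGerm_const _).mul he) (by
        have : (f 0)⁻¹ * e 0 = f 0 * e 0 / (f 0) ^ 2 := by field_simp
        rw [this]
        positivity)
    refine ⟨fun x => weightedDilation w (s x) x, ⟨?_, isCongruentVia_weightedDilation w hB h hs hs0⟩,
      ?_⟩
    · refine isDiffeoGerm_of_jacobian_ne_zero hk0 (map_zero _) (hs.weightedDilation w) ?_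
      rw [hdet.self_of_nhds]
      exact mul_ne_zero (inv_ne_zero hf0) (right_ne_zero_of_mul he0.ne')
    · filter_upwards [hdet] with x hx
      rw [hx, mul_inv_cancel_left₀ hf0]
  obtain ⟨θ, ⟨hθ, hθB⟩, hθf⟩ := key f hf (mul_self_pos.2 hf0)
  obtain ⟨η, ⟨hη, hηB⟩, hηg⟩ := key g hg hfg
  obtain ⟨θ', hθ', -, h2⟩ := hθ.exists_inverse
  exact ⟨fun x => θ' (η x), ⟨hθ'.comp hη, (hθB.symm hθ' h2).trans hη hηB⟩,
    (hθf.symm hk0 hθ hθ' h2).trans hk0 hθ' hη hηg⟩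

theorem transportsDensity_jacobian (Φ : (Fin r → ℝ) → (Fin r → ℝ)) (f : (Fin r → ℝ) → ℝ) :
    TransportsDensity Φ f fun x => f (Φ x) * (fderiv ℝ Φ x).det :=
  Eventually.of_forall fun _ => rfl

theorem IsRegularGerm.pullbackDensity (hk : k = ∞ ∨ k = ω) {f : (Fin r → ℝ) → ℝ}
    (hf : IsRegularGerm k f) {Φ : (Fin r → ℝ) → (Fin r → ℝ)} (hΦ : IsDiffeoGerm k Φ) :
    IsRegularGerm k fun x => f (Φ x) * (fderiv ℝ Φ x).det :=
  (hf.comp hΦ.2.1 hΦ.1).mul (isRegularGerm_jacobian hΦ.2.1 (add_one_le_of_smooth_or_analytic hk))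

/-- The isotropy group of a symmetrically quasi-homogeneous germ acts transitively on densities
of a given sign. -/
theorem IsSymQuasiHomogeneous.exists_transportsDensity (hk : k = ∞ ∨ k = ω)
    {A : (Fin r → ℝ) → Matrix (Fin n) (Fin n) ℝ} (hA : IsMatrixGerm k A)
    (hqh : IsSymQuasiHomogeneous k A) {f g : (Fin r → ℝ) → ℝ} (hf : IsRegularGerm k f)
    (hg : IsRegularGerm k g) (hfg : 0 < f 0 * g 0) :
    ∃ Θ ∈ isotropyGroup k A, TransportsDensity Θ f g := by
  have hk0 := ne_zero_of_smooth_or_analytic hk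
  obtain ⟨φ, w, δ, X, B, hφ, hX, hw, hB, hdil⟩ := hqh
  have hAB : IsCongruentVia k φ A B := ⟨X, hX, by rw [hB]⟩
  have hBreg : IsMatrixGerm k B := by
    rw [hB]
    exact (hX.1.transpose.mul (hA.comp hφ.2.1 hφ.1)).mul hX.1
  obtain ⟨φ', hφ', -, h2⟩ := hφ.exists_inverse
  -- The problem is moved to quasi-homogeneous coordinates. Pulling back by `φ` multiplies both
  -- densities by the same determinant, so the sign condition survives even if `φ` reverses
  -- orientation.
  obtain ⟨θ, ⟨hθ, hθB⟩, hθfg⟩ := exists_transportsDensity_of_quasiHomogeneous hk hw (B := B)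
    (fun i j => (hBreg i j).mono fun x hx => hx.continuousAt)
    (fun t ht i j => hdil t i j (Or.inl ht.le))
    (hf.pullbackDensity hk hφ) (hg.pullbackDensity hk hφ) (by
      have := hφ.jacobian_ne_zero hk0
      simp only [hφ.1]
      have h3 : f 0 * (fderiv ℝ φ 0).det * (g 0 * (fderiv ℝ φ 0).det) =
        f 0 * g 0 * (fderiv ℝ φ 0).det ^ 2 := by ring
      rw [h3]
      positivity)
  refine ⟨fun x => φ (θ (φ' x)), ⟨hφ.comp (hθ.comp hφ'),
    hAB.trans (hθ.comp hφ') (hθB.trans hφ' (hAB.symm hφ' h2))⟩, ?_⟩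
  exact (transportsDensity_jacobian φ f).trans hk0 hφ (hθ.comp hφ')
    (hθfg.trans hk0 hθ hφ' ((transportsDensity_jacobian φ g).symm hk0 hφ hφ' h2))

/-- The volume defect of `Φ` is corrected by a symmetry of `A`: with `Ψ = Φ⁻¹`, some `Θ` in `𝓓_A`
pulls `Ω` back to `Ψ^*Ω`, and `Θ ∘ Φ` then preserves `Ω`. -/
theorem volumePreservingEquivalent_of_orientationPreserving (hk : k = ∞ ∨ k = ω)
    {Ω : (Fin r → ℝ) → (Fin r → ℝ) [⋀^Fin r]→L[ℝ] ℝ} (hΩ : IsVolumeFormGerm k Ω)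
    {A B : (Fin r → ℝ) → Matrix (Fin n) (Fin n) ℝ} (hA : IsMatrixGerm k A)
    (hqh : IsSymQuasiHomogeneous k A) (h : OrientationPreservingEquivalent k A B) :
    VolumePreservingEquivalent k Ω A B := by
  have hk0 := ne_zero_of_smooth_or_analytic hk
  obtain ⟨Φ, hΦ, hpos, hAB⟩ := h
  obtain ⟨Ψ, hΨ, h1, h2⟩ := hΦ.exists_inverse
  have hω := hΩ.isRegularGerm_formDensity
  have hΨdet : 0 < (fderiv ℝ Ψ 0).det := by
    have h3 := (jacobian_comp hΨ.2.1 hΦ.2.1 hΦ.1 hk0).self_of_nhds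
    rw [(jacobian_of_eventually_eq_id h1).self_of_nhds, hΦ.1] at h3
    exact pos_of_mul_pos_left (h3 ▸ one_pos) (le_of_lt hpos)
  obtain ⟨Θ, ⟨hΘ, hΘA⟩, hΘω⟩ := hqh.exists_transportsDensity hk hA hω
    (hω.pullbackDensity hk hΨ) (by
      rw [hΨ.1, ← mul_assoc]
      exact mul_pos (mul_self_pos.2 hΩ.formDensity_ne_zero) hΨdet)
  exact ⟨fun x => Θ (Φ x), hΘ.comp hΦ,
    preservesForm_iff.2 (hΘω.trans hk0 hΘ hΦ
      ((transportsDensity_jacobian Ψ _).symm hk0 hΨ hΦ h1)),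
    hΘA.trans hΦ hAB⟩

end Transitivity

/-! ### The reflection of the first coordinate -/

section Reflection

variable {r n : ℕ} {k : WithTop ℕ∞}

/-- The reflection `(x₁, x₂, …) ↦ (-x₁, x₂, …)`. -/
noncomputable def firstReflection (r : ℕ) : (Fin r → ℝ) →L[ℝ] (Fin r → ℝ) :=
  ContinuousLinearMap.pi fun l =>
    (if (l : ℕ) = 0 then -1 else 1 : ℝ) • ContinuousLinearMap.proj l

theorem firstReflection_apply (x : Fin r → ℝ) :
    firstReflection r x = fun l : Fin r => if (l : ℕ) = 0 then -x l else x l := by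
  ext l
  by_cases h : (l : ℕ) = 0 <;> simp [firstReflection, h]

theorem reflectFirst_eq (A : (Fin r → ℝ) → Matrix (Fin n) (Fin n) ℝ) :
    reflectFirst A = fun x => A (firstReflection r x) := by
  simp only [firstReflection_apply]
  rfl

theorem firstReflection_firstReflection (x : Fin r → ℝ) :
    firstReflection r (firstReflection r x) = x := by
  ext l
  by_cases h : (l : ℕ) = 0 <;> simp [firstReflection, h]

theorem isDiffeoGerm_firstReflection : IsDiffeoGerm k (firstReflection r) :=
  have hreg : IsRegularGerm k (firstReflection r) :=
    isRegularGerm_of_contDiff (firstReflection r).contDiff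
  ⟨map_zero _, hreg, _, map_zero _, hreg, Eventually.of_forall firstReflection_firstReflection,
    Eventually.of_forall firstReflection_firstReflection⟩

theorem jacobian_firstReflection (hr : 0 < r) (x : Fin r → ℝ) :
    (fderiv ℝ (firstReflection r) x).det = -1 := by
  rw [ContinuousLinearMap.fderiv]
  have : (firstReflection r).toLinearMap =
      Matrix.toLin' (Matrix.diagonal fun l : Fin r => if (l : ℕ) = 0 then (-1 : ℝ) else 1) := by
    ext x l
    by_cases h : (l : ℕ) = 0 <;> simp [firstReflection, Matrix.mulVec_diagonal, h]
  rw [ContinuousLinearMap.det, this, LinearMap.det_toLin', Matrix.det_diagonal]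
  obtain ⟨m, rfl⟩ := Nat.exists_eq_succ_of_ne_zero hr.ne'
  simp

theorem isCongruentVia_reflectFirst (A : (Fin r → ℝ) → Matrix (Fin n) (Fin n) ℝ) :
    IsCongruentVia k (firstReflection r) A (reflectFirst A) :=
  ⟨fun _ => 1, isGLGerm_one, by simp [reflectFirst_eq]⟩

theorem IsMatrixGerm.reflectFirst {A : (Fin r → ℝ) → Matrix (Fin n) (Fin n) ℝ}
    (hA : IsMatrixGerm k A) : IsMatrixGerm k (reflectFirst A) := by
  rw [reflectFirst_eq]
  exact hA.comp isDiffeoGerm_firstReflection.2.1 (map_zero _)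

/-- The reflection is an involution, so composing the chart with it leaves the normal form `B` and
its weights unchanged. -/
theorem IsSymQuasiHomogeneous.reflectFirst {A : (Fin r → ℝ) → Matrix (Fin n) (Fin n) ℝ}
    (hA : IsSymQuasiHomogeneous k A) : IsSymQuasiHomogeneous k (reflectFirst A) := by
  obtain ⟨φ, w, δ, X, B, hφ, hX, hw, hB, h⟩ := hA
  refine ⟨fun x => firstReflection r (φ x), w, δ, X, B, isDiffeoGerm_firstReflection.comp hφ, hX,
    hw, ?_, h⟩
  simp only [hB, reflectFirst_eq, firstReflection_firstReflection]

/-- Needed because for `r = 0` the reflection is the identity and does not reverse orientation. -/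
theorem IsSymQuasiHomogeneous.dim_pos {A : (Fin r → ℝ) → Matrix (Fin n) (Fin n) ℝ}
    (hA : IsSymQuasiHomogeneous k A) : 0 < r := by
  obtain ⟨_, w, _, _, _, _, _, hw, _⟩ := hA
  rcases Nat.eq_zero_or_pos r with rfl | hr
  · simp at hw
  · exact hr

theorem jacobian_comp_zero {Φ Ψ : (Fin r → ℝ) → (Fin r → ℝ)} (hk : k ≠ 0)
    (hΦ : IsDiffeoGerm k Φ) (hΨ : IsDiffeoGerm k Ψ) :
    (fderiv ℝ (fun x => Φ (Ψ x)) 0).det = (fderiv ℝ Φ 0).det * (fderiv ℝ Ψ 0).det := by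
  have h := (jacobian_comp hΦ.2.1 hΨ.2.1 hΨ.1 hk).self_of_nhds
  rwa [hΨ.1] at h

theorem PreservesForm.jacobian_zero {Ω : (Fin r → ℝ) → (Fin r → ℝ) [⋀^Fin r]→L[ℝ] ℝ}
    (hΩ : IsVolumeFormGerm k Ω) {Φ : (Fin r → ℝ) → (Fin r → ℝ)} (h : PreservesForm Ω Φ)
    (h0 : Φ 0 = 0) : (fderiv ℝ Φ 0).det = 1 := by
  have h1 := (preservesForm_iff.1 h).self_of_nhds
  rw [h0] at h1
  exact mul_left_cancel₀ hΩ.formDensity_ne_zero (h1.trans (mul_one _).symm)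

end Reflection

/-! ### The proposition -/

theorem mainTheorem2 {r n : ℕ} (k : WithTop ℕ∞) (hk : k = ∞ ∨ k = ω)
    (Ω : (Fin r → ℝ) → (Fin r → ℝ) [⋀^Fin r]→L[ℝ] ℝ) (hΩ : IsVolumeFormGerm k Ω)
    (A : (Fin r → ℝ) → Matrix (Fin n) (Fin n) ℝ) (hA : IsSymGerm k A)
    (hqh : IsSymQuasiHomogeneous k A) :
    ((∃ Φ ∈ isotropyGroup k A, IsOrientationReversing Φ) →
      ∀ B : (Fin r → ℝ) → Matrix (Fin n) (Fin n) ℝ, IsSymGerm k B →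
        GEquivalent k A B → VolumePreservingEquivalent k Ω A B) ∧
    ((∀ Φ ∈ isotropyGroup k A, IsOrientationPreserving Φ) →
      (∀ B : (Fin r → ℝ) → Matrix (Fin n) (Fin n) ℝ, IsSymGerm k B →
        OrientationPreservingEquivalent k A B → VolumePreservingEquivalent k Ω A B) ∧
      (∀ B : (Fin r → ℝ) → Matrix (Fin n) (Fin n) ℝ, IsSymGerm k B →
        GEquivalent k A B → ¬ OrientationPreservingEquivalent k A B →
          VolumePreservingEquivalent k Ω (reflectFirst A) B) ∧
      ¬ VolumePreservingEquivalent k Ω A (reflectFirst A)) := by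
  have hk0 := ne_zero_of_smooth_or_analytic hk
  have hρ : IsDiffeoGerm k (firstReflection r) := isDiffeoGerm_firstReflection
  have hρdet := jacobian_firstReflection hqh.dim_pos 0
  have hρA : IsCongruentVia k (firstReflection r) (reflectFirst A) A :=
    (isCongruentVia_reflectFirst A).symm hρ (Eventually.of_forall firstReflection_firstReflection)
  refine ⟨?_, fun hpos => ⟨fun B _ => ?_, ?_, ?_⟩⟩
  · rintro ⟨Ψ, ⟨hΨ, hΨA⟩, hrev⟩ B - ⟨Φ, hΦ, hAB⟩
    refine volumePreservingEquivalent_of_orientationPreserving hk hΩ hA.1 hqh ?_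
    rcases (hΦ.jacobian_ne_zero hk0).lt_or_gt with hneg | hpos
    -- An orientation-reversing symmetry of `A` repairs the sign of `Φ`.
    · refine ⟨fun x => Ψ (Φ x), hΨ.comp hΦ, ?_, hΨA.trans hΦ hAB⟩
      rw [IsOrientationPreserving, jacobian_comp_zero hk0 hΨ hΦ]
      exact mul_pos_of_neg_of_neg hrev hneg
    · exact ⟨Φ, hΦ, hpos, hAB⟩
  · exact volumePreservingEquivalent_of_orientationPreserving hk hΩ hA.1 hqh
  · rintro B - ⟨Φ, hΦ, hAB⟩ hnot
    refine volumePreservingEquivalent_of_orientationPreserving hk hΩ hA.1.reflectFirst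
      hqh.reflectFirst ?_
    rcases (hΦ.jacobian_ne_zero hk0).lt_or_gt with hneg | hpos
    -- Here `A` has no reversing symmetry; the reflection repairs the sign at the cost of replacing
    -- `A` by its reflected germ.
    · refine ⟨fun x => firstReflection r (Φ x), hρ.comp hΦ, ?_, hρA.trans hΦ hAB⟩
      rw [IsOrientationPreserving, jacobian_comp_zero hk0 hρ hΦ, hρdet]
      linarith
    · exact absurd ⟨Φ, hΦ, hpos, hAB⟩ hnot
  · rintro ⟨Φ, hΦ, hpres, hAA⟩
    -- Followed by the reflection back to `A`, such a `Φ` gives an element of `𝓓_A`; its determinant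
    -- at `0` is `1 * (-1)`, against the assumption.
    have h := hpos _ ⟨hΦ.comp hρ, hAA.trans hρ hρA⟩
    rw [IsOrientationPreserving, jacobian_comp_zero hk0 hΦ hρ, hρdet,
      hpres.jacobian_zero hΩ hΦ.1] at h
    linarith
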